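/- Let $X$ be a real random variable with distribution function $F$ and tail $\bar F=1-F$. Assume $\alpha>0$ and that there is $\varepsilon>0$ with $\mathbb E[e^{(1+\varepsilon)X}]<\infty$. Let $R_\alpha$ be the class of measurable, eventually positive functions $g$ with $g(\lambda x)/g(x)\to\lambda^\alpha$ as $x\to\infty$ for every $\lambda>0$, and write $g\sim h$ if $g(k)/h(k)\to1$ as $k\to\infty$. Let $$c(k)=\int_k^\infty(e^x-e^k)\,dF(x),\qquad c_{BS}(k,\sigma)=\Phi\Big(-\frac k\sigma+\frac\sigma2\Big)-e^k\,\Phi\Big(-\frac k\sigma-\frac\sigma2\Big)\quad(\sigma>0),$$ where $\Phi$ is the standard normal distribution function, and let the implied volatility $V(k)$ be the solution $\sigma>0$ of $c_{BS}(k,\sigma)=c(k)$; for all sufficiently large $k$ with $c(k)>0$ this solution exists and is unique. Put $\psi[x]=2-4(\sqrt{x^2+x}-x)$. In statements involving $f$, $X$ is assumed to have a probability density function $f$. Consider (i) $-\log f\in R_\alpha$; (ii) $-\log\bar F\in R_\alpha$; (iii) $-\log c\in R_\alpha$; (iv) $V(k)^2/k\sim\psi[-\log c(k)/k]$. Then (i)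 $\Rightarrow$ (ii) $\Rightarrow$ (iii) $\Rightarrow$ (iv). If (ii) holds, then $-\log c(k)\sim-k-\log\bar F(k)$ and $V(k)^2/k\sim\psi[-1-\log\bar F(k)/k]$. If (i) holds, then $-\log f\sim-\log\bar F$ and $V(k)^2/k\sim\psi[-1-\log f(k)/k]$. Finally, in each of the following cases $V(k)^2/k\to0$ as $k\to\infty$, with the stated asymptotics: if (i) holds and $-\log f(k)/k\to\infty$, then $V(k)^2/k\sim\frac{1}{-2\log f(k)/k}$; if (ii) holds and $-\log\bar F(k)/k\to\infty$, then $V(k)^2/k\sim\frac{1}{-2\log\bar F(k)/k}$; if $c(k)>0$ for all large $k$ and $-\log c(k)/k\to\infty$, then $V(k)^2/k\sim\frac{1}{-2\log c(k)/k}$. -/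

import Mathlib

open Real Set Filter Topology MeasureTheory ProbabilityTheory

noncomputable section

namespace TailWing

/-- `g ∼ h` as `k → ∞`: the quotient `g k / h k` tends to `1`. -/
def Equiv (g h : ℝ → ℝ) : Prop :=
  Tendsto (fun k => g k / h k) atTop (𝓝 1)

/-- `g ∈ R_α`: a measurable, eventually positive function, regularly varying at `+∞`
with index `α`. -/
structure RegVar (α : ℝ) (g : ℝ → ℝ) : Prop where
  measurable : Measurable g
  eventually_pos : ∀ᶠ x in atTop, 0 < g x
  tendsto : ∀ t : ℝ, 0 < t → Tendsto (fun x => g (t * x) / g x) atTop (𝓝 (t ^ α))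

/-- The standard normal distribution function `Φ`. -/
def Phi (x : ℝ) : ℝ := cdf (gaussianReal 0 1) x

/-- Normalized Black-Scholes call price with log-strike `k` and (total) volatility `σ`
(meaningful for `σ > 0`). -/
def cBS (k σ : ℝ) : ℝ :=
  Phi (-k / σ + σ / 2) - exp k * Phi (-k / σ - σ / 2)

/-- The function `ψ[x] = 2 - 4 (√(x² + x) - x)`, for `x ≥ 0`. -/
def psi (x : ℝ) : ℝ := 2 - 4 * (√(x ^ 2 + x) - x)

variable {Ω : Type*} [MeasurableSpace Ω]

/-- The tail `F̄ = 1 - F` of the distribution function of `X`. -/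
def tail (P : Measure Ω) (X : Ω → ℝ) (k : ℝ) : ℝ := 1 - cdf (P.map X) k

/-- `f` is a probability density function of `X`. -/
structure IsDensity (P : Measure Ω) (X : Ω → ℝ) (f : ℝ → ℝ) : Prop where
  measurable : Measurable f
  nonneg : ∀ x, 0 ≤ f x
  map_eq : P.map X = volume.withDensity (fun x => ENNReal.ofReal (f x))

/-- The normalized call price `c(k) = ∫_k^∞ (e^x - e^k) dF(x)`. -/
def call (P : Measure Ω) (X : Ω → ℝ) (k : ℝ) : ℝ :=
  ∫ x in Ioi k, (exp x - exp k) ∂(P.map X)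

/-- The implied volatility `V(k)`: the `σ > 0` with `cBS k σ = c(k)`. For `k > 0` there is at
most one such `σ`, so the infimum only picks the element of a one-point set. -/
def impliedVol (P : Measure Ω) (X : Ω → ℝ) (k : ℝ) : ℝ :=
  sInf {σ : ℝ | 0 < σ ∧ cBS k σ = call P X k}

end TailWing

end

namespace TailWing

/-! The function `psi` solves the Black-Scholes equation on the logarithmic scale. If `σ² = ψ(L) k`,
then `d₁ = -k/σ + σ/2` satisfies `d₁²/2 = k L` (`sq_d1_eq`), so with `L = -log c(k) / k` the value
`Φ(d₁)` is about `c(k)` up to subexponential factors. The Chernoff bound gives `cBS k σ < c(k)`,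
hence `σ < V(k)`. Conversely, integrating the vega over `(aσ, bσ)` with `1 < a < b` gives at least
`exp(-k L / a²)` times a prefactor, which eventually exceeds `c(k)`, hence `V(k) ≤ bσ`
(`equiv_psi_of_cBS_eq`). This needs only `L` bounded away from `0`, which the exponential moment
supplies.

Density, tail and call price are linked by Laplace-type estimates. Lower bounds use the mass
slightly to the right of `k`, where regular variation keeps the exponent close to its value at `k`.
Upper bounds use `g x ≥ s g k` for all `x ≥ k`, with `s < 1`: a share `s` of the exponent yields the
decay in `k`, and the share `1 - s` grows at least linearly and makes the integral converge.

The call price involves the tail exponent minus `k`. The moment condition puts that exponent above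
`(1 + δ) k`, so the subtraction preserves both regular variation and equivalence. Finally `psi`
respects equivalence, because `psi` decreases while `x ψ(x)` increases. -/

/-! ### Asymptotic equivalence. -/

theorem Equiv.symm {g h : ℝ → ℝ} (H : Equiv g h) : Equiv h g := by
  have := Tendsto.inv₀ H one_ne_zero
  simpa [Equiv, inv_div] using this

theorem Equiv.trans {g h l : ℝ → ℝ} (H₁ : Equiv g h) (H₂ : Equiv h l) : Equiv g l := by
  have := Tendsto.mul H₁ H₂
  rw [mul_one] at this
  refine this.congr' ?_
  -- Division by zero gives `0`, so a quotient tending to `1` forces a nonzero denominator.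
  filter_upwards [Tendsto.eventually_ne H₁ one_ne_zero] with k hk
  have : h k ≠ 0 := by
    intro h0
    simp [h0] at hk
  field_simp

theorem equiv_of_forall_bounds {g h : ℝ → ℝ} (hh : ∀ᶠ k in atTop, 0 < h k)
    (hu : ∀ r : ℝ, 1 < r → ∀ᶠ k in atTop, g k ≤ r * h k)
    (hl : ∀ r : ℝ, 0 < r → r < 1 → ∀ᶠ k in atTop, r * h k ≤ g k) : Equiv g h := by
  refine tendsto_order.2 ⟨fun r hr => ?_, fun r hr => ?_⟩
  · obtain ⟨s, hs, hs1⟩ := exists_between (max_lt hr zero_lt_one)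
    filter_upwards [hh, hl s ((le_max_right _ _).trans_lt hs) hs1] with k hk hk'
    exact ((le_max_left _ _).trans_lt hs).trans_le ((le_div_iff₀ hk).2 hk')
  · obtain ⟨s, hs, hs1⟩ := exists_between hr
    filter_upwards [hh, hu s hs] with k hk hk'
    exact ((div_le_iff₀ hk).2 hk').trans_lt hs1

theorem Equiv.eventually_pos {g h : ℝ → ℝ} (H : Equiv g h) (hh : ∀ᶠ k in atTop, 0 < h k) :
    ∀ᶠ k in atTop, 0 < g k := by
  filter_upwards [Tendsto.eventually_const_lt zero_lt_one H, hh] with k hk hk'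
  exact (div_pos_iff_of_pos_right hk').1 hk

theorem tendsto_const_mul_atTop_self {t : ℝ} (ht : 0 < t) :
    Tendsto (fun x : ℝ => t * x) atTop atTop :=
  tendsto_id.const_mul_atTop ht

theorem RegVar.of_equiv {α : ℝ} {a b : ℝ → ℝ} (hb : RegVar α b) (ha : Measurable a)
    (hab : Equiv a b) : RegVar α a := by
  refine ⟨ha, hab.eventually_pos hb.eventually_pos, fun t ht => ?_⟩
  have hT := tendsto_const_mul_atTop_self ht
  have h := ((Tendsto.comp hab hT).mul (hb.tendsto t ht)).mul hab.symm
  rw [one_mul, mul_one] at h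
  refine h.congr' ?_
  filter_upwards [hb.eventually_pos, hT.eventually hb.eventually_pos] with x h1 h2
  simp only [Function.comp]
  field_simp

/-! ### Uniform convergence for regularly varying functions. -/

/-- The uniform convergence theorem for regularly varying functions, in additive form. -/
theorem eventually_forall_abs_sub_le {H : ℝ → ℝ} (hH : Measurable H) {α : ℝ}
    (h : ∀ u, Tendsto (fun x => H (x + u) - H x) atTop (𝓝 (α * u))) {δ : ℝ} (hδ : 0 < δ) :
    ∀ᶠ x in atTop, ∀ u ∈ Icc (0 : ℝ) 1, |H (x + u) - H x - α * u| ≤ δ := by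
  by_contra hcon
  obtain ⟨x, hx, hx'⟩ := exists_seq_forall_of_frequently (not_eventually.1 hcon)
  push Not at hx'
  choose u hu hu' using hx'
  have hy : Tendsto (fun n => x n + u n) atTop atTop :=
    tendsto_atTop_mono (fun n => by linarith [(hu n).1]) hx
  -- Pointwise convergence implies convergence in measure on `[0, 2]`, an interval that contains `u
  -- + v` for all `u, v ∈ [0, 1]`. It is used from both base points `x n` and `x n + u n`.
  have key : ∀ z : ℕ → ℝ, Tendsto z atTop atTop →
      Tendsto (fun n => volume.restrict (Icc (0 : ℝ) 2)
        {v | δ / 2 ≤ |H (z n + v) - H (z n) - α * v|}) atTop (𝓝 0) := by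
    intro z hz
    have := tendstoInMeasure_of_tendsto_ae (μ := volume.restrict (Icc (0 : ℝ) 2))
      (f := fun n v => H (z n + v) - H (z n)) (g := fun v => α * v)
      (fun n => ((hH.comp (measurable_const_add _)).sub_const _).aestronglyMeasurable)
      (ae_of_all _ fun v => (h v).comp hz)
    exact tendstoInMeasure_iff_norm.1 this (δ / 2) (half_pos hδ)
  have h4 : (0 : ENNReal) < 1 / 2 := by simp
  obtain ⟨n, hn1, hn2⟩ := (((key x hx).eventually_lt_const h4).and
    ((key _ hy).eventually_lt_const h4)).exists
  rw [Measure.restrict_apply' measurableSet_Icc] at hn1 hn2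
  set A := {v | δ / 2 ≤ |H (x n + v) - H (x n) - α * v|} ∩ Icc (0 : ℝ) 2
  set B := {v | δ / 2 ≤ |H (x n + u n + v) - H (x n + u n) - α * v|} ∩ Icc (0 : ℝ) 2
  -- Two bad sets of measure below `1/2` cannot cover `[0, 1]`. A remaining `v` makes `x n + u n +
  -- v` good from both base points, and subtracting bounds the increment over `u n`.
  have hsub : ¬ Icc (0 : ℝ) 1 ⊆ ((fun v => u n + v) ⁻¹' A) ∪ B := by
    intro hs
    have h1 := (measure_mono (μ := volume) hs).trans (measure_union_le _ _)
    rw [measure_preimage_add] at h1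
    have h2 := h1.trans_lt (ENNReal.add_lt_add hn1 hn2)
    rw [ENNReal.add_halves] at h2
    simp at h2
  obtain ⟨v, hv, hv'⟩ := not_subset.1 hsub
  simp only [mem_union, not_or, mem_preimage, A, B, mem_inter_iff, mem_ofPred_eq, not_and'] at hv'
  have e1 := hv'.1 ⟨add_nonneg (hu n).1 hv.1, by linarith [(hu n).2, hv.2]⟩
  have e2 := hv'.2 ⟨hv.1, by linarith [hv.2]⟩
  have e3 := hu' n
  rw [← add_assoc] at e1
  rw [not_le, abs_lt] at e1 e2
  rw [lt_abs] at e3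
  rcases e3 with e3 | e3 <;> linarith [e1.1, e1.2, e2.1, e2.2]

/-- The uniform convergence theorem for regularly varying functions. -/
theorem RegVar.eventually_forall_Icc {α : ℝ} {g : ℝ → ℝ} (hg : RegVar α g) {δ : ℝ}
    (hδ : 0 < δ) :
    ∀ᶠ x in atTop, ∀ t ∈ Icc (1 : ℝ) (exp 1),
      exp (-δ) * t ^ α * g x ≤ g (t * x) ∧ g (t * x) ≤ exp δ * t ^ α * g x := by
  have hU := eventually_forall_abs_sub_le (H := fun x => log (g (exp x))) (α := α)
    (measurable_log.comp (hg.measurable.comp measurable_exp)) (fun u => ?_) hδ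
  · obtain ⟨N, hN⟩ := eventually_atTop.1 hg.eventually_pos
    filter_upwards [tendsto_log_atTop.eventually hU, eventually_ge_atTop N,
      eventually_gt_atTop 0] with x hx hxN hx0 t ht
    have ht0 : 0 < t := zero_lt_one.trans_le ht.1
    have h1 := hx (log t) ⟨log_nonneg ht.1, by
      rw [log_le_iff_le_exp ht0]; exact ht.2⟩
    have hgx := hN x hxN
    have hgt := hN (t * x) (hxN.trans (le_mul_of_one_le_left hx0.le ht.1))
    rw [exp_add, exp_log hx0, exp_log ht0, mul_comm x t, abs_le] at h1
    rw [rpow_def_of_pos ht0]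
    have e : g (t * x) = exp (log (g (t * x)) - log (g x)) * g x := by
      rw [exp_sub, exp_log hgx, exp_log hgt, div_mul_cancel₀ _ hgx.ne']
    rw [e, ← exp_add, ← exp_add]
    constructor <;>
    · refine mul_le_mul_of_nonneg_right (exp_le_exp.2 ?_) hgx.le
      linarith [h1.1, h1.2]
  · have h1 := (hg.tendsto (exp u) (exp_pos u)).comp tendsto_exp_atTop
    have h2 := h1.log (rpow_pos_of_pos (exp_pos u) α).ne'
    rw [log_rpow (exp_pos u), log_exp] at h2
    have hT := tendsto_const_mul_atTop_self (exp_pos u)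
    refine h2.congr' ?_
    filter_upwards [tendsto_exp_atTop.eventually hg.eventually_pos,
      tendsto_exp_atTop.eventually (hT.eventually hg.eventually_pos)] with x hx hx'
    simp only [Function.comp]
    rw [log_div hx'.ne' hx.ne', exp_add, mul_comm (exp x)]

/-- The factor `r` is lost only once, on `[k, e k]`. With error `δ = α`, the gain `e ^ α` of a full
step cancels the loss `exp (-α)`, so `g (e y) ≥ g y` and nothing accumulates. -/
theorem RegVar.eventually_forall_ge {α : ℝ} (hα : 0 < α) {g : ℝ → ℝ} (hg : RegVar α g)
    {r : ℝ} (hr : 0 < r) (hr1 : r < 1) :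
    ∀ᶠ k in atTop, ∀ x, k ≤ x → r * g k ≤ g x := by
  have hδ : 0 < -log r := neg_pos.2 (log_neg hr hr1)
  obtain ⟨K, hK⟩ := eventually_atTop.1 (((hg.eventually_forall_Icc hδ).and
    (hg.eventually_forall_Icc hα)).and (hg.eventually_pos.and (eventually_gt_atTop 0)))
  have he : (1 : ℝ) ≤ exp 1 := one_le_exp zero_le_one
  filter_upwards [eventually_ge_atTop K] with k hk
  obtain ⟨⟨h1, -⟩, hgk, hk0⟩ := hK k hk
  have key : ∀ n : ℕ, ∀ x, k ≤ x → x ≤ exp 1 ^ (n + 1) * k → r * g k ≤ g x := by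
    intro n
    induction n with
    | zero =>
      intro x hx hx'
      rw [zero_add, pow_one] at hx'
      have ht : 1 ≤ x / k := (one_le_div hk0).2 hx
      have h2 := (h1 (x / k) ⟨ht, (div_le_iff₀ hk0).2 hx'⟩).1
      rw [neg_neg, exp_log hr, div_mul_cancel₀ _ hk0.ne'] at h2
      refine le_trans ?_ h2
      refine mul_le_mul_of_nonneg_right ?_ hgk.le
      exact le_mul_of_one_le_right hr.le (one_le_rpow ht hα.le)
    | succ n ih =>
      intro x hx hx'
      by_cases hc : x ≤ exp 1 ^ (n + 1) * k
      · exact ih x hx hc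
      · have hx1 : x / exp 1 ≤ exp 1 ^ (n + 1) * k := by
          rw [div_le_iff₀ (exp_pos 1)]
          calc x ≤ _ := hx'
            _ = _ := by ring
        have hx2 : k ≤ x / exp 1 := by
          rw [le_div_iff₀ (exp_pos 1)]
          refine le_trans ?_ (not_le.1 hc).le
          rw [mul_comm]
          exact mul_le_mul_of_nonneg_right (le_self_pow₀ he (Nat.succ_ne_zero n)) hk0.le
        refine (ih _ hx2 hx1).trans ?_
        have h3 := ((hK _ (hk.trans hx2)).1.2 (exp 1) ⟨he, le_rfl⟩).1
        rwa [← exp_mul, one_mul, ← exp_add, neg_add_cancel, exp_zero, one_mul,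
          mul_div_cancel₀ _ (exp_pos 1).ne'] at h3
  intro x hx
  obtain ⟨n, hn⟩ := pow_unbounded_of_one_lt (x / k) (one_lt_exp_iff.2 zero_lt_one)
  refine key n x hx ((div_le_iff₀ hk0).1 (hn.le.trans ?_))
  exact pow_le_pow_right₀ he n.le_succ

/-! ### Regularly varying functions above the identity. -/

theorem RegVar.tendsto_div_id_two_mul {α : ℝ} {g : ℝ → ℝ} (hg : RegVar α g) :
    Tendsto (fun x => (g (2 * x) / (2 * x)) / (g x / x)) atTop (𝓝 (2 ^ (α - 1))) := by
  have h := (hg.tendsto 2 two_pos).div_const 2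
  rw [show (2 : ℝ) ^ α / 2 = 2 ^ (α - 1) by rw [rpow_sub_one two_ne_zero]] at h
  refine h.congr' ?_
  filter_upwards [eventually_gt_atTop 0, hg.eventually_pos] with x hx hgx
  field_simp

/-- For a smaller index, `g x / x` would decay geometrically along `2 ^ n * K`. -/
theorem RegVar.one_le_index {α : ℝ} {g : ℝ → ℝ} (hg : RegVar α g)
    (hl : ∀ᶠ x in atTop, x ≤ g x) : 1 ≤ α := by
  by_contra hα
  have h1 : (2 : ℝ) ^ (α - 1) < 1 := rpow_lt_one_of_one_lt_of_neg one_lt_two (by linarith)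
  obtain ⟨q, hq, hq1⟩ := exists_between h1
  have hq0 : 0 < q := (rpow_pos_of_pos two_pos _).trans hq
  obtain ⟨K, hK⟩ := eventually_atTop.1 ((hg.tendsto_div_id_two_mul.eventually_lt_const hq).and
    (hl.and (eventually_gt_atTop 0)))
  have hK0 := (hK K le_rfl).2.2
  have hge : ∀ n : ℕ, K ≤ 2 ^ n * K := fun n =>
    le_mul_of_one_le_left hK0.le (one_le_pow₀ one_le_two)
  have hφ : ∀ x, K ≤ x → 1 ≤ g x / x := fun x hx => (one_le_div (hK x hx).2.2).2 (hK x hx).2.1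
  have key : ∀ n : ℕ, g (2 ^ n * K) / (2 ^ n * K) ≤ q ^ n * (g K / K) := by
    intro n
    induction n with
    | zero => simp
    | succ n ih =>
      have h2 := (hK _ (hge n)).1
      rw [div_lt_iff₀ (zero_lt_one.trans_le (hφ _ (hge n))), ← mul_assoc, ← pow_succ'] at h2
      refine h2.le.trans ?_
      rw [pow_succ', mul_assoc]
      exact mul_le_mul_of_nonneg_left ih hq0.le
  have h0 : Tendsto (fun n : ℕ => q ^ n * (g K / K)) atTop (𝓝 (0 * (g K / K))) :=
    (tendsto_pow_atTop_nhds_zero_of_lt_one hq0.le hq1).mul_const _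
  rw [zero_mul] at h0
  obtain ⟨n, hn⟩ := (h0.eventually_lt_const zero_lt_one).exists
  exact absurd ((hφ _ (hge n)).trans (key n)) (not_le.2 hn)

theorem RegVar.tendsto_div_id_atTop {α : ℝ} (hα : 1 < α) {g : ℝ → ℝ} (hg : RegVar α g)
    (hl : ∀ᶠ x in atTop, x ≤ g x) : Tendsto (fun x => g x / x) atTop atTop := by
  have h1 : 1 < (2 : ℝ) ^ (α - 1) := one_lt_rpow one_lt_two (by linarith)
  obtain ⟨q, hq1, hq⟩ := exists_between h1
  obtain ⟨K, hK⟩ := eventually_atTop.1 ((hg.tendsto_div_id_two_mul.eventually_const_lt hq).and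
    (hl.and (eventually_gt_atTop 0)))
  have hK0 := (hK K le_rfl).2.2
  have hφ : ∀ x, K ≤ x → 1 ≤ g x / x := fun x hx => (one_le_div (hK x hx).2.2).2 (hK x hx).2.1
  have key : ∀ n : ℕ, ∀ x, 2 ^ n * K ≤ x → q ^ n ≤ g x / x := by
    intro n
    induction n with
    | zero => intro x hx; simpa using hφ x (by simpa using hx)
    | succ n ih =>
      intro x hx
      have hx2 : 2 ^ n * K ≤ x / 2 := by
        rw [le_div_iff₀ two_pos]
        calc 2 ^ n * K * 2 = 2 ^ (n + 1) * K := by ring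
          _ ≤ x := hx
      have hKx : K ≤ x / 2 :=
        (le_mul_of_one_le_left hK0.le (one_le_pow₀ one_le_two)).trans hx2
      have h2 := (hK _ hKx).1
      rw [lt_div_iff₀ (zero_lt_one.trans_le (hφ _ hKx)), mul_div_cancel₀ _ two_ne_zero] at h2
      refine le_trans ?_ h2.le
      rw [pow_succ']
      exact mul_le_mul_of_nonneg_left (ih _ hx2) (zero_lt_one.trans hq1).le
  refine tendsto_atTop.2 fun b => ?_
  obtain ⟨n, hn⟩ := pow_unbounded_of_one_lt b hq1
  filter_upwards [eventually_ge_atTop (2 ^ n * K)] with x hx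
  exact hn.le.trans (key n x hx)

/-- Either `α = 1`, the index of the identity itself, or `α > 1` and `x / g x → 0`; in both cases
`(t ^ α - t) x / g x → 0`. The margin `δ` keeps `1 - x / g x` away from `0`. -/
theorem RegVar.sub_id {α : ℝ} {g : ℝ → ℝ} (hg : RegVar α g) {δ : ℝ} (hδ : 0 < δ)
    (hl : ∀ᶠ x in atTop, (1 + δ) * x ≤ g x) : RegVar α (fun x => g x - x) := by
  have hl1 : ∀ᶠ x in atTop, x ≤ g x := by
    filter_upwards [hl, eventually_gt_atTop 0] with x hx hx0
    nlinarith
  refine ⟨hg.measurable.sub measurable_id, ?_, fun t ht => ?_⟩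
  · filter_upwards [hl, eventually_gt_atTop 0] with x hx hx0
    nlinarith
  have h0 : Tendsto (fun x => (t ^ α - t) * (x / g x)) atTop (𝓝 0) := by
    rcases hg.one_le_index hl1 |>.eq_or_lt with h1 | h1
    · simp [← h1]
    · have := (hg.tendsto_div_id_atTop h1 hl1).inv_tendsto_atTop.const_mul (t ^ α - t)
      simpa [inv_div] using this
  have h1 : Tendsto (fun x => g (t * x) / g x - t ^ α + (t ^ α - t) * (x / g x)) atTop (𝓝 0) := by
    simpa using ((hg.tendsto t ht).sub_const (t ^ α)).add h0
  have h2 : Tendsto (fun x => (g (t * x) / g x - t ^ α + (t ^ α - t) * (x / g x)) *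
      (1 - x / g x)⁻¹) atTop (𝓝 0) := by
    refine h1.zero_mul_isBoundedUnder_le ?_
    refine ⟨(1 + δ) / δ, eventually_map.2 ?_⟩
    filter_upwards [hl, eventually_gt_atTop 0, hg.eventually_pos] with x hx hx0 hgx
    have h3 : x / g x ≤ 1 / (1 + δ) := by
      rw [div_le_div_iff₀ hgx (by positivity)]
      linarith
    have h4 : δ / (1 + δ) ≤ 1 - x / g x := by
      have : δ / (1 + δ) = 1 - 1 / (1 + δ) := by field_simp; ring
      linarith
    have h5 : 0 < δ / (1 + δ) := by positivity
    simp only [Function.comp, norm_eq_abs]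
    rw [abs_of_pos (inv_pos.2 (h5.trans_le h4)), ← inv_div δ]
    exact inv_anti₀ h5 h4
  have h3 := h2.add_const (t ^ α)
  rw [zero_add] at h3
  refine h3.congr' ?_
  filter_upwards [hl, eventually_gt_atTop 0, hg.eventually_pos] with x hx hx0 hgx
  have h4 : g x - x ≠ 0 := by nlinarith
  have h5 : 1 - x / g x = (g x - x) / g x := by field_simp
  rw [h5]
  field_simp
  ring

/-! ### The function `psi`. -/

theorem psi_eq {x : ℝ} (hx : 0 ≤ x) : psi x = 2 * (√(x + 1) - √x) ^ 2 := by
  have h : √(x ^ 2 + x) = √x * √(x + 1) := by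
    rw [← sqrt_mul hx]; ring_nf
  rw [psi, h]
  have h1 := sq_sqrt hx
  have h2 := sq_sqrt (show 0 ≤ x + 1 by linarith)
  linear_combination (-2) * h1 - 2 * h2

theorem psi_eq_div {x : ℝ} (hx : 0 ≤ x) : psi x = 2 / (√(x + 1) + √x) ^ 2 := by
  have h1 := sq_sqrt hx
  have h2 := sq_sqrt (show 0 ≤ x + 1 by linarith)
  have h3 : 0 < √(x + 1) := sqrt_pos.2 (by linarith)
  have h4 : 0 < √(x + 1) + √x := by positivity
  have h5 : (√(x + 1) - √x) * (√(x + 1) + √x) = 1 := by linear_combination h2 - h1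
  rw [psi_eq hx, eq_div_iff (by positivity)]
  linear_combination (2 * ((√(x + 1) - √x) * (√(x + 1) + √x) + 1)) * h5

theorem psi_pos {x : ℝ} (hx : 0 ≤ x) : 0 < psi x := by
  have h3 : 0 < √(x + 1) := sqrt_pos.2 (by linarith)
  rw [psi_eq_div hx]
  positivity

/-- `psi` inverts `v ↦ (2 - v)² / (8 v)`. -/
theorem two_sub_psi_sq {x : ℝ} (hx : 0 ≤ x) : (2 - psi x) ^ 2 = 8 * psi x * x := by
  have h := sq_sqrt (show 0 ≤ x ^ 2 + x by positivity)
  rw [psi]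
  linear_combination 16 * h

theorem psi_antitone {x y : ℝ} (hx : 0 ≤ x) (hxy : x ≤ y) : psi y ≤ psi x := by
  rw [psi_eq_div hx, psi_eq_div (hx.trans hxy)]
  have h3 : 0 < √(x + 1) := sqrt_pos.2 (by linarith)
  gcongr

theorem psi_lt_two {x : ℝ} (hx : 0 < x) : psi x < 2 := by
  have : x < √(x ^ 2 + x) := lt_sqrt_of_sq_lt (by linarith)
  rw [psi]
  linarith

theorem mul_psi_eq {x : ℝ} (hx : 0 < x) : x * psi x = 2 / (√(1 + 1 / x) + 1) ^ 2 := by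
  have h : √(x + 1) = √x * √(1 + 1 / x) := by
    rw [← sqrt_mul hx.le]; congr 1; field_simp
  have h1 : 0 < √x := sqrt_pos.2 hx
  have h2 : (√(x + 1) + √x) ^ 2 = x * (√(1 + 1 / x) + 1) ^ 2 := by
    rw [h, ← mul_add_one, mul_pow, sq_sqrt hx.le]
  rw [psi_eq_div hx.le, h2]
  field_simp

theorem mul_psi_mono {x y : ℝ} (hx : 0 < x) (hxy : x ≤ y) : x * psi x ≤ y * psi y := by
  have hy : 0 < y := hx.trans_le hxy
  rw [mul_psi_eq hx, mul_psi_eq hy]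
  gcongr

/-- Monotonicity of `psi` and of `x ψ(x)` places `ψ(a) / ψ(b)` between `min 1 (b/a)` and `max 1
(b/a)`, with no assumption that `a` or `b` converges. -/
theorem equiv_psi_of_equiv {a b : ℝ → ℝ} (hb : ∀ᶠ k in atTop, 0 < b k) (hab : Equiv a b) :
    Equiv (fun k => psi (a k)) (fun k => psi (b k)) := by
  have ha := hab.eventually_pos hb
  have h1 : Tendsto (fun k => min 1 (b k / a k)) atTop (𝓝 1) := by
    have := Tendsto.min (tendsto_const_nhds (x := (1 : ℝ)) (f := atTop)) hab.symm
    simpa using this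
  have h2 : Tendsto (fun k => max 1 (b k / a k)) atTop (𝓝 1) := by
    have := Tendsto.max (tendsto_const_nhds (x := (1 : ℝ)) (f := atTop)) hab.symm
    simpa using this
  refine tendsto_of_tendsto_of_tendsto_of_le_of_le' h1 h2 ?_ ?_
  · filter_upwards [ha, hb] with k ha hb
    rw [le_div_iff₀ (psi_pos hb.le)]
    rcases le_total (a k) (b k) with h | h
    · exact (mul_le_of_le_one_left (psi_pos hb.le).le (min_le_left _ _)).trans
        (psi_antitone ha.le h)
    · refine (mul_le_mul_of_nonneg_right (min_le_right _ _) (psi_pos hb.le).le).trans ?_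
      rw [div_mul_eq_mul_div, div_le_iff₀ ha, mul_comm (psi _)]
      exact mul_psi_mono hb h
  · filter_upwards [ha, hb] with k ha hb
    rw [div_le_iff₀ (psi_pos hb.le)]
    rcases le_total (a k) (b k) with h | h
    · refine le_trans ?_ (mul_le_mul_of_nonneg_right (le_max_right _ _) (psi_pos hb.le).le)
      rw [div_mul_eq_mul_div, le_div_iff₀ ha, mul_comm (psi _)]
      exact mul_psi_mono ha h
    · exact (psi_antitone hb.le h).trans
        (le_mul_of_one_le_left (psi_pos hb.le).le (le_max_left _ _))

theorem psi_equiv_of_atTop {a : ℝ → ℝ} (ha : Tendsto a atTop atTop) :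
    Equiv (fun k => psi (a k)) (fun k => 1 / (2 * a k)) := by
  have h1 : Tendsto (fun k => 4 / (√(1 + (a k)⁻¹) + 1) ^ 2) atTop
      (𝓝 (4 / (√(1 + 0) + 1) ^ 2)) := by
    refine Tendsto.div tendsto_const_nhds ?_ (by positivity)
    exact (((ha.inv_tendsto_atTop.const_add 1).sqrt).add_const 1).pow 2
  have h2 : (4 : ℝ) / (√(1 + 0) + 1) ^ 2 = 1 := by norm_num
  rw [h2] at h1
  refine h1.congr' ?_
  filter_upwards [ha.eventually_gt_atTop 0] with k hk
  have := mul_psi_eq hk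
  rw [div_div_eq_mul_div, div_one, show psi (a k) * (2 * a k) = 2 * (a k * psi (a k)) by ring,
    this, one_div]
  ring

theorem psi_tendsto_zero {a : ℝ → ℝ} (ha : Tendsto a atTop atTop) :
    Tendsto (fun k => psi (a k)) atTop (𝓝 0) := by
  have h := (Tendsto.mul (psi_equiv_of_atTop ha)
    ((ha.const_mul_atTop two_pos).inv_tendsto_atTop))
  rw [mul_zero] at h
  refine h.congr' ?_
  filter_upwards [ha.eventually_gt_atTop 0] with k hk
  simp only [Pi.inv_apply]
  field_simp

/-! ### The Black-Scholes price and its inversion. -/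

theorem gaussianPDFReal_std (x : ℝ) :
    gaussianPDFReal 0 1 x = (√(2 * π))⁻¹ * exp (-x ^ 2 / 2) := by
  simp [gaussianPDFReal]

theorem Phi_eq_integral (x : ℝ) : Phi x = ∫ t in Iic x, gaussianPDFReal 0 1 t := by
  rw [Phi, cdf_eq_real, measureReal_def, gaussianReal_apply_eq_integral 0 one_ne_zero,
    ENNReal.toReal_ofReal]
  exact integral_nonneg fun t => gaussianPDFReal_nonneg _ _ _

theorem hasDerivAt_Phi (x : ℝ) : HasDerivAt Phi (gaussianPDFReal 0 1 x) x := by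
  have hi := integrable_gaussianPDFReal 0 1
  have hc : Continuous (gaussianPDFReal 0 1) := by
    rw [funext gaussianPDFReal_std]
    fun_prop
  have h := (intervalIntegral.integral_hasDerivAt_right (a := 0) (b := x)
    hi.intervalIntegrable (hc.stronglyMeasurableAtFilter _ _) hc.continuousAt).add_const (Phi 0)
  refine h.congr_of_eventuallyEq (Eventually.of_forall fun y => ?_)
  beta_reduce
  rw [← intervalIntegral.integral_Iic_sub_Iic hi.integrableOn hi.integrableOn,
    Phi_eq_integral, Phi_eq_integral]
  ring

theorem Phi_nonneg (x : ℝ) : 0 ≤ Phi x := cdf_nonneg _ _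

theorem Phi_pos (x : ℝ) : 0 < Phi x := by
  have hm : StrictMono Phi := strictMono_of_deriv_pos fun x => by
    rw [(hasDerivAt_Phi x).deriv]
    exact gaussianPDFReal_pos _ _ _ one_ne_zero
  exact (Phi_nonneg _).trans_lt (hm (sub_one_lt x))

/-- Chernoff's bound at its optimal parameter, `x` itself. -/
theorem Phi_le_exp {x : ℝ} (hx : x ≤ 0) : Phi x ≤ exp (-x ^ 2 / 2) := by
  have h := measure_le_le_exp_mul_mgf (μ := gaussianReal 0 1) (X := id) x hx
    (integrable_exp_mul_gaussianReal x)
  rw [mgf_gaussianReal (Measure.map_id), ← exp_add] at h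
  rw [Phi, cdf_eq_real]
  refine h.trans_eq ?_
  norm_num
  ring

/-- This identity cancels the `k / σ ^ 2` terms in the vega, leaving a single positive density. -/
theorem exp_mul_gaussianPDFReal (k : ℝ) {σ : ℝ} (hσ : σ ≠ 0) :
    exp k * gaussianPDFReal 0 1 (-k / σ - σ / 2) = gaussianPDFReal 0 1 (-k / σ + σ / 2) := by
  rw [gaussianPDFReal_std, gaussianPDFReal_std, mul_left_comm, ← exp_add]
  congr 2
  field_simp
  ring

theorem hasDerivAt_cBS (k : ℝ) {σ : ℝ} (hσ : σ ≠ 0) :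
    HasDerivAt (cBS k) (gaussianPDFReal 0 1 (-k / σ + σ / 2)) σ := by
  have h0 : HasDerivAt (fun s : ℝ => -k / s) (k / σ ^ 2) σ := by
    have := (hasDerivAt_inv hσ).const_mul (-k)
    simp only [← div_eq_mul_inv] at this
    refine this.congr_deriv ?_
    ring
  have h1 := h0.add ((hasDerivAt_id σ).div_const 2)
  have h2 := h0.sub ((hasDerivAt_id σ).div_const 2)
  have h3 := ((hasDerivAt_Phi (-k / σ + σ / 2)).comp σ h1).sub
    (((hasDerivAt_Phi (-k / σ - σ / 2)).comp σ h2).const_mul (exp k))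
  refine h3.congr_deriv ?_
  linear_combination (1 / 2 - k / σ ^ 2) * exp_mul_gaussianPDFReal k hσ

theorem strictMonoOn_cBS (k : ℝ) : StrictMonoOn (cBS k) (Ioi 0) := by
  refine strictMonoOn_of_deriv_pos (convex_Ioi 0)
    (fun s hs => (hasDerivAt_cBS k (ne_of_gt hs)).continuousAt.continuousWithinAt) fun s hs => ?_
  rw [interior_Ioi] at hs
  rw [(hasDerivAt_cBS k (ne_of_gt hs)).deriv]
  exact gaussianPDFReal_pos _ _ _ one_ne_zero

theorem cBS_lt_Phi (k σ : ℝ) : cBS k σ < Phi (-k / σ + σ / 2) :=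
  sub_lt_self _ (mul_pos (exp_pos _) (Phi_pos _))

theorem tendsto_cBS_zero {k : ℝ} (hk : 0 < k) : Tendsto (cBS k) (𝓝[>] 0) (𝓝 0) := by
  have h0 : Tendsto (fun s : ℝ => -k / s) (𝓝[>] 0) atBot := by
    have := tendsto_inv_nhdsGT_zero.const_mul_atTop_of_neg (neg_lt_zero.2 hk)
    simpa only [div_eq_mul_inv] using this
  have h1 : Tendsto (fun s : ℝ => s / 2) (𝓝[>] 0) (𝓝 0) := by
    have : Tendsto (fun s : ℝ => s / 2) (𝓝 0) (𝓝 (0 / 2)) := tendsto_id.div_const 2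
    rw [zero_div] at this
    exact this.mono_left nhdsWithin_le_nhds
  have hΦ : Tendsto Phi atBot (𝓝 0) := tendsto_cdf_atBot _
  have h2 := (hΦ.comp (h0.atBot_add h1)).sub
    ((hΦ.comp (h0.atBot_add h1.neg)).const_mul (exp k))
  rw [mul_zero, sub_zero] at h2
  exact h2.congr fun s => by simp [cBS, sub_eq_add_neg]

theorem tendsto_cBS_one (k : ℝ) : Tendsto (cBS k) atTop (𝓝 1) := by
  have h0 : Tendsto (fun s : ℝ => -k / s) atTop (𝓝 0) := tendsto_const_nhds.div_atTop tendsto_id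
  have h1 : Tendsto (fun s : ℝ => s / 2) atTop atTop := tendsto_id.atTop_div_const two_pos
  have h3 : Tendsto (fun s : ℝ => -(s / 2)) atTop atBot := tendsto_neg_atTop_atBot.comp h1
  have hΦ : Tendsto Phi atBot (𝓝 0) := tendsto_cdf_atBot _
  have hΦ' : Tendsto Phi atTop (𝓝 1) := tendsto_cdf_atTop _
  have h2 := (hΦ'.comp (h0.add_atTop h1)).sub
    ((hΦ.comp (h0.add_atBot h3)).const_mul (exp k))
  rw [mul_zero, sub_zero] at h2
  exact h2.congr fun s => by simp [cBS, sub_eq_add_neg]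

theorem cBS_nonneg {k σ : ℝ} (hk : 0 < k) (hσ : 0 < σ) : 0 ≤ cBS k σ := by
  refine le_of_tendsto (tendsto_cBS_zero hk) ?_
  filter_upwards [Ioo_mem_nhdsGT hσ] with s hs
  exact (strictMonoOn_cBS k hs.1 hσ hs.2).le

theorem exists_cBS_eq {k c : ℝ} (hk : 0 < k) (hc : 0 < c) (hc1 : c < 1) :
    ∃ σ, 0 < σ ∧ cBS k σ = c := by
  obtain ⟨a, ha, ha0⟩ := (((tendsto_cBS_zero hk).eventually_lt_const hc).and
    self_mem_nhdsWithin).exists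
  obtain ⟨b, hb, hb0⟩ := (((tendsto_cBS_one k).eventually_const_lt hc1).and
    (eventually_gt_atTop 0)).exists
  have hcont : ContinuousOn (cBS k) (Ioi 0) := fun s hs =>
    (hasDerivAt_cBS k (ne_of_gt hs)).continuousAt.continuousWithinAt
  obtain ⟨σ, hσ, h⟩ := isPreconnected_Ioi.intermediate_value ha0 hb0 hcont ⟨ha.le, hb.le⟩
  exact ⟨σ, hσ, h⟩

theorem cBS_inj {k σ τ : ℝ} (hσ : 0 < σ) (hτ : 0 < τ) (h : cBS k σ = cBS k τ) : σ = τ :=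
  (strictMonoOn_cBS k).injOn hσ hτ h

/-- Lower bound on the Black-Scholes price through the vega. -/
theorem vega_mul_le_cBS {k a b m : ℝ} (hk : 0 < k) (ha : 0 < a) (hab : a < b)
    (hm : ∀ s ∈ Ioo a b, m ≤ gaussianPDFReal 0 1 (-k / s + s / 2)) :
    m * (b - a) ≤ cBS k b := by
  obtain ⟨s, hs, h⟩ := exists_hasDerivAt_eq_slope (cBS k)
    (fun s => gaussianPDFReal 0 1 (-k / s + s / 2)) hab
    (fun s hs => (hasDerivAt_cBS k (ha.trans_le hs.1).ne').continuousAt.continuousWithinAt)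
    (fun s hs => hasDerivAt_cBS k (ha.trans hs.1).ne')
  have h1 := hm s hs
  rw [h, le_div_iff₀ (sub_pos.2 hab)] at h1
  linarith [cBS_nonneg hk ha]

/-- With `σ² = ψ(L) k` one has `d₁² / 2 = k L`. -/
theorem sq_d1_eq {k L σ : ℝ} (hL : 0 ≤ L) (hσ : 0 < σ) (h : σ ^ 2 = psi L * k) :
    (-k / σ + σ / 2) ^ 2 / 2 = k * L := by
  have h1 := two_sub_psi_sq hL
  have h2 : (-k / σ + σ / 2) ^ 2 / 2 = (σ ^ 2 - 2 * k) ^ 2 / (8 * σ ^ 2) := by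
    field_simp
    ring
  rw [h2, div_eq_iff (by positivity), h]
  linear_combination k ^ 2 * h1

theorem cBS_lt_exp {k L σ : ℝ} (hk : 0 < k) (hL : 0 < L) (hσ : 0 < σ) (h : σ ^ 2 = psi L * k) :
    cBS k σ < exp (-(k * L)) := by
  refine (cBS_lt_Phi k σ).trans_le ((Phi_le_exp ?_).trans_eq ?_)
  · have h1 : σ ^ 2 ≤ 2 * k := by
      rw [h]
      exact mul_le_mul_of_nonneg_right (psi_lt_two hL).le hk.le
    have h2 : -k / σ + σ / 2 = (σ ^ 2 - 2 * k) / (2 * σ) := by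
      field_simp
      ring
    rw [h2]
    exact div_nonpos_of_nonpos_of_nonneg (by linarith) (by positivity)
  · rw [neg_div, sq_d1_eq hL.le hσ h]

/-- The condition on `b` keeps `s² ≤ 2k` on `(aσ, bσ)`, so `d₁ ≤ 0` there. Replacing `s` by `σ` in
the numerator of `d₁²/2` and by `aσ` in its denominator bounds it by `k L / a²`. -/
theorem exp_le_cBS {k L σ a b : ℝ} (hk : 0 < k) (hL : 0 ≤ L) (hσ : 0 < σ)
    (h : σ ^ 2 = psi L * k) (ha : 1 < a) (hab : a < b) (hb : b ^ 2 * psi L ≤ 2) :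
    (√(2 * π))⁻¹ * exp (-(k * L / a ^ 2)) * ((b - a) * σ) ≤ cBS k (b * σ) := by
  have ha0 : 0 < a := zero_lt_one.trans ha
  rw [sub_mul]
  refine vega_mul_le_cBS hk (mul_pos ha0 hσ) (mul_lt_mul_of_pos_right hab hσ) fun s hs => ?_
  rw [gaussianPDFReal_std]
  refine mul_le_mul_of_nonneg_left (exp_le_exp.2 ?_) (by positivity)
  have hs0 : 0 < s := (mul_pos ha0 hσ).trans hs.1
  have h1 : s ^ 2 ≤ 2 * k := by
    calc s ^ 2 ≤ (b * σ) ^ 2 := pow_le_pow_left₀ hs0.le hs.2.le 2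
      _ = b ^ 2 * psi L * k := by rw [mul_pow, h]; ring
      _ ≤ 2 * k := mul_le_mul_of_nonneg_right hb hk.le
  have h3 : (a * σ) ^ 2 ≤ s ^ 2 := pow_le_pow_left₀ (mul_pos ha0 hσ).le hs.1.le 2
  have h4 : σ ^ 2 ≤ s ^ 2 := by
    refine le_trans ?_ h3
    exact pow_le_pow_left₀ hσ.le (le_mul_of_one_le_left hσ.le ha.le) 2
  have h2 : (-k / s + s / 2) ^ 2 / 2 = (2 * k - s ^ 2) ^ 2 / (8 * s ^ 2) := by
    field_simp
    ring
  have h5 : (2 * k - s ^ 2) ^ 2 / (8 * s ^ 2) ≤ (2 * k - σ ^ 2) ^ 2 / (8 * (a * σ) ^ 2) := by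
    have : 0 < a * σ := mul_pos ha0 hσ
    have h6 : 0 ≤ 2 * k - s ^ 2 := by linarith
    gcongr
  have h6 : (2 * k - σ ^ 2) ^ 2 / (8 * (a * σ) ^ 2) = k * L / a ^ 2 := by
    rw [← sq_d1_eq hL hσ h]
    field_simp
    ring
  rw [neg_div, neg_le_neg_iff, h2]
  exact h5.trans_eq h6

/-- Asymptotic inversion of the Black-Scholes formula. -/
theorem equiv_psi_of_cBS_eq {V c : ℝ → ℝ} {δ : ℝ} (hδ : 0 < δ)
    (hV : ∀ᶠ k in atTop, 0 < V k ∧ cBS k (V k) = c k)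
    (hc : ∀ᶠ k in atTop, 0 < c k) (hL : ∀ᶠ k in atTop, δ ≤ -log (c k) / k) :
    Equiv (fun k => V k ^ 2 / k) (fun k => psi (-log (c k) / k)) := by
  have hbase : ∀ᶠ k in atTop, 0 < k ∧ 0 < V k ∧ cBS k (V k) = exp (-(k * (-log (c k) / k))) ∧
      δ ≤ -log (c k) / k := by
    filter_upwards [hV, hc, hL, eventually_gt_atTop 0] with k h1 h2 h3 h4
    refine ⟨h4, h1.1, ?_, h3⟩
    rw [mul_div_cancel₀ _ h4.ne', neg_neg, exp_log h2, h1.2]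
  set L := fun k => -log (c k) / k
  have hpos : ∀ᶠ k in atTop, 0 < psi (L k) := by
    filter_upwards [hL] with k hk
    exact psi_pos (hδ.le.trans hk)
  refine equiv_of_forall_bounds hpos (fun r hr => ?_) fun r hr hr1 => ?_
  · -- a factor `b` with `b² ≤ r` and `b² ψ(δ) ≤ 2`
    have hψ := psi_pos hδ.le
    have hψ2 : 1 < 2 / psi δ := (one_lt_div hψ).2 (psi_lt_two hδ)
    set q := min r (2 / psi δ) with hq
    have hq1 : 1 < q := lt_min hr hψ2
    have hb1 : 1 < √q := lt_sqrt_of_sq_lt (by linarith)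
    have hbq : √q ^ 2 = q := sq_sqrt (by linarith)
    set b := √q
    obtain ⟨a, ha, hab⟩ := exists_between hb1
    have ha2 : 1 < a ^ 2 := one_lt_pow₀ ha two_ne_zero
    set β := 1 - 1 / a ^ 2 with hβ
    have hβ0 : 0 < β := by
      rw [hβ, sub_pos, div_lt_one (by linarith)]
      exact ha2
    -- With `y = k L`, the gap `β` between the exponents `y` and `y / a²` must beat the prefactor.
    -- The comparison is squared below to remove the root in `σ`.
    have hlim : Tendsto (fun y : ℝ => y * exp (-(2 * β) * y)) atTop (𝓝 0) := by
      have := tendsto_rpow_mul_exp_neg_mul_atTop_nhds_zero 1 (2 * β) (by positivity)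
      simpa using this
    set C := δ * psi δ * (b - a) ^ 2 / (2 * π) with hC
    have hC0 : 0 < C := by
      have : 0 < b - a := sub_pos.2 hab
      positivity
    have hyy : Tendsto (fun k => k * L k) atTop atTop := by
      refine tendsto_atTop_mono' _ ?_ (tendsto_id.atTop_mul_const hδ)
      filter_upwards [hbase] with k hk
      exact mul_le_mul_of_nonneg_left hk.2.2.2 hk.1.le
    filter_upwards [hbase, (hyy.eventually (hlim.eventually_lt_const hC0)),
      eventually_ge_atTop 1] with k ⟨hk, hVk, hcV, hLk⟩ hy hk1
    have hLk0 : 0 < L k := hδ.trans_le hLk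
    have hψk := psi_pos hLk0.le
    have hσ2 : √(psi (L k) * k) ^ 2 = psi (L k) * k := sq_sqrt (by positivity)
    have hσ : 0 < √(psi (L k) * k) := sqrt_pos.2 (by positivity)
    set σ := √(psi (L k) * k)
    have hb2 : b ^ 2 * psi (L k) ≤ 2 := by
      calc b ^ 2 * psi (L k) ≤ 2 / psi δ * psi δ := by
            rw [hbq]
            exact mul_le_mul (min_le_right _ _) (psi_antitone hδ.le hLk) hψk.le (by positivity)
        _ = 2 := div_mul_cancel₀ _ hψ.ne'
    have hmain := exp_le_cBS hk hLk0.le hσ hσ2 ha hab hb2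
    have hge : exp (-(k * L k)) ≤
        (√(2 * π))⁻¹ * exp (-(k * L k / a ^ 2)) * ((b - a) * σ) := by
      have hba : 0 < b - a := sub_pos.2 hab
      refine (pow_le_pow_iff_left₀ (by positivity) (by positivity) two_ne_zero).1 ?_
      have e1 : ((√(2 * π))⁻¹ * exp (-(k * L k / a ^ 2)) * ((b - a) * σ)) ^ 2
          = (2 * π)⁻¹ * exp (-(k * L k / a ^ 2)) ^ 2 * (b - a) ^ 2 * (psi (L k) * k) := by
        rw [mul_pow, mul_pow, mul_pow, hσ2, inv_pow, sq_sqrt (by positivity)]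
        ring
      have e2 : exp (-(k * L k)) ^ 2
          = exp (-(k * L k / a ^ 2)) ^ 2 * exp (-(2 * β) * (k * L k)) := by
        rw [← exp_nat_mul, ← exp_nat_mul, ← exp_add]
        congr 1
        rw [hβ]
        push_cast
        field_simp
        ring
      have e3 : exp (-(2 * β) * (k * L k)) ≤ (2 * π)⁻¹ * (b - a) ^ 2 * (psi (L k) * k) := by
        -- Since `x ψ(x)` increases, `σ²` is at least a constant over `k L`, even if `L` is
        -- unbounded.
        have h1 : δ * psi δ ≤ psi (L k) * k * (k * L k) := by
          calc δ * psi δ ≤ L k * psi (L k) := mul_psi_mono hδ hLk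
            _ ≤ L k * psi (L k) * k ^ 2 :=
              le_mul_of_one_le_right (by positivity) (one_le_pow₀ hk1)
            _ = _ := by ring
        have h2 : 0 < k * L k := by positivity
        refine le_of_mul_le_mul_left ?_ h2
        refine hy.le.trans ?_
        calc C = (δ * psi δ) * ((b - a) ^ 2 / (2 * π)) := by rw [hC]; ring
          _ ≤ (psi (L k) * k * (k * L k)) * ((b - a) ^ 2 / (2 * π)) :=
            mul_le_mul_of_nonneg_right h1 (by positivity)
          _ = _ := by ring
      rw [e1, e2]
      calc _ ≤ exp (-(k * L k / a ^ 2)) ^ 2 * ((2 * π)⁻¹ * (b - a) ^ 2 * (psi (L k) * k)) :=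
            mul_le_mul_of_nonneg_left e3 (by positivity)
        _ = _ := by ring
    have hb0 : 0 < b := zero_lt_one.trans hb1
    have hVle : V k ≤ b * σ := by
      refine ((strictMonoOn_cBS k).le_iff_le hVk (mul_pos hb0 hσ)).1 ?_
      rw [hcV]
      exact hge.trans hmain
    rw [div_le_iff₀ hk]
    calc V k ^ 2 ≤ (b * σ) ^ 2 := pow_le_pow_left₀ hVk.le hVle 2
      _ = q * (psi (L k) * k) := by rw [mul_pow, hbq, hσ2]
      _ ≤ r * (psi (L k) * k) := mul_le_mul_of_nonneg_right (min_le_left _ _) (by positivity)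
      _ = _ := by ring
  · filter_upwards [hbase] with k ⟨hk, hVk, hcV, hLk⟩
    have hLk0 : 0 < L k := hδ.trans_le hLk
    have hψk := psi_pos hLk0.le
    have hσ2 : √(psi (L k) * k) ^ 2 = psi (L k) * k := sq_sqrt (by positivity)
    have hσ : 0 < √(psi (L k) * k) := sqrt_pos.2 (by positivity)
    set σ := √(psi (L k) * k)
    -- The lower bound is exact: `σ < V k`, with no loss of a factor.
    have hlt := cBS_lt_exp hk hLk0 hσ hσ2
    rw [← hcV] at hlt
    have hσV := ((strictMonoOn_cBS k).lt_iff_lt hσ hVk).1 hlt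
    refine (mul_le_of_le_one_left hψk.le hr1.le).trans ?_
    rw [le_div_iff₀ hk, ← hσ2]
    exact pow_le_pow_left₀ hσ.le hσV.le 2

/-! ### Comparison on the logarithmic scale. -/

/-- The constant costs `log C`, which `(q - r) * G k` absorbs. The bound is uniform in `y`, so `y`
may depend on `k`. -/
theorem eventually_mul_le_neg_log {G : ℝ → ℝ} (hG : Tendsto G atTop atTop) {r q : ℝ}
    (hrq : r < q) (C : ℝ) :
    ∀ᶠ k in atTop, ∀ y, 0 < y → y ≤ exp (-(q * G k)) * C → r * G k ≤ -log y := by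
  filter_upwards [(hG.const_mul_atTop (sub_pos.2 hrq)).eventually_ge_atTop (log C)]
    with k hk y hy hyC
  have hC : 0 < C := pos_of_mul_pos_right (hy.trans_le hyC) (exp_pos _).le
  have h := log_le_log hy hyC
  rw [log_mul (exp_pos _).ne' hC.ne', log_exp] at h
  linarith

theorem eventually_neg_log_le_mul {G : ℝ → ℝ} (hG : Tendsto G atTop atTop) {r q : ℝ}
    (hqr : q < r) {C : ℝ} (hC : 0 < C) :
    ∀ᶠ k in atTop, ∀ y, exp (-(q * G k)) * C ≤ y → -log y ≤ r * G k := by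
  filter_upwards [(hG.const_mul_atTop (sub_pos.2 hqr)).eventually_ge_atTop (-log C)]
    with k hk y hyC
  have h := log_le_log (mul_pos (exp_pos _) hC) hyC
  rw [log_mul (exp_pos _).ne' hC.ne', log_exp] at h
  linarith

/-- Allows the factor `s = (1 + r) / 2` to be spent twice: as the share of the exponent kept, and in
`s * g k ≤ g x`. -/
theorem lt_sq_half_one_add {r : ℝ} (hr : r < 1) : r < ((1 + r) / 2) ^ 2 := by
  nlinarith [sq_pos_of_pos (sub_pos.2 hr)]

/-! ### Bounds on tail and call price. -/

theorem measureReal_Ioi_eq_integral_density {μ : Measure ℝ} {f : ℝ → ℝ}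
    (hf : Measurable f) (hf0 : ∀ x, 0 ≤ f x)
    (hμ : μ = volume.withDensity fun x => ENNReal.ofReal (f x)) (k : ℝ) :
    μ.real (Ioi k) = ∫ x in Ioi k, f x := by
  rw [integral_eq_lintegral_of_nonneg_ae (ae_of_all _ hf0) hf.aestronglyMeasurable,
    measureReal_def, hμ, withDensity_apply _ measurableSet_Ioi]

theorem setIntegral_payoff_eq {μ : Measure ℝ} (k : ℝ) :
    ∫ x in Ioi k, (exp x - exp k) ∂μ = ∫ x, max (exp x - exp k) 0 ∂μ := by
  rw [← integral_indicator measurableSet_Ioi]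
  refine integral_congr_ae (ae_of_all _ fun x => ?_)
  beta_reduce
  by_cases h : x ∈ Ioi k
  · rw [indicator_of_mem h, max_eq_left (sub_nonneg.2 (exp_le_exp.2 (le_of_lt h)))]
  · rw [indicator_of_notMem h, max_eq_right (sub_nonpos.2 (exp_le_exp.2 (not_lt.1 h)))]

section

variable {μ : Measure ℝ} [IsProbabilityMeasure μ] {ε : ℝ}

theorem measureReal_Ioi_le (hε : 0 < ε) (hI : Integrable (fun x => exp ((1 + ε) * x)) μ) (k : ℝ) :
    μ.real (Ioi k) ≤ exp (-((1 + ε) * k)) * ∫ x, exp ((1 + ε) * x) ∂μ := by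
  have h := measure_ge_le_exp_mul_mgf (μ := μ) (X := fun x => x) (t := 1 + ε) k (by linarith) hI
  rw [neg_mul] at h
  refine (measureReal_mono fun x hx => ?_).trans h
  rw [mem_ofPred_eq]
  exact le_of_lt hx

theorem integrable_exp_of_exp_mul (hε : 0 < ε)
    (hI : Integrable (fun x => exp ((1 + ε) * x)) μ) : Integrable (fun x => exp x) μ := by
  refine (hI.add (integrable_const 1)).mono' (by fun_prop) (ae_of_all _ fun x => ?_)
  rw [norm_eq_abs, abs_of_pos (exp_pos x), Pi.add_apply]
  rcases le_total x 0 with h | h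
  · linarith [exp_le_one_iff.2 h, exp_pos ((1 + ε) * x)]
  · have : exp x ≤ exp ((1 + ε) * x) := exp_le_exp.2 (by nlinarith)
    linarith

theorem integrable_payoff (hE : Integrable (fun x => exp x) μ) (k : ℝ) :
    Integrable (fun x => max (exp x - exp k) 0) μ :=
  (hE.sub (integrable_const _)).pos_part

theorem antitone_setIntegral_payoff (hE : Integrable (fun x => exp x) μ) :
    Antitone fun k => ∫ x in Ioi k, (exp x - exp k) ∂μ := by
  intro k l hkl
  simp only [setIntegral_payoff_eq]
  refine integral_mono (integrable_payoff hE l) (integrable_payoff hE k) fun x => ?_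
  have := exp_le_exp.2 hkl
  exact max_le_max (by linarith) le_rfl

theorem setIntegral_payoff_le (hε : 0 < ε) (hI : Integrable (fun x => exp ((1 + ε) * x)) μ)
    (k : ℝ) : ∫ x in Ioi k, (exp x - exp k) ∂μ ≤
      exp (-(ε * k)) * ∫ x, exp ((1 + ε) * x) ∂μ := by
  rw [setIntegral_payoff_eq, ← integral_const_mul]
  refine integral_mono (integrable_payoff (integrable_exp_of_exp_mul hε hI) k) (hI.const_mul _)
    fun x => ?_
  refine max_le ?_ (by positivity)
  beta_reduce
  rw [← exp_add]
  rcases le_total x k with h | h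
  · have := exp_le_exp.2 h
    linarith [exp_pos (-(ε * k) + (1 + ε) * x)]
  · have : exp x ≤ exp (-(ε * k) + (1 + ε) * x) := exp_le_exp.2 (by nlinarith)
    linarith [exp_pos k]

theorem le_setIntegral_payoff (hE : Integrable (fun x => exp x) μ) (k b : ℝ) :
    (exp b - exp k) * μ.real (Ioi b) ≤ ∫ x in Ioi k, (exp x - exp k) ∂μ := by
  rw [setIntegral_payoff_eq, mul_comm, ← smul_eq_mul, ← integral_indicator_const _ measurableSet_Ioi]
  refine integral_mono ((integrable_const _).indicator measurableSet_Ioi)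
    (integrable_payoff hE k) fun x => ?_
  by_cases h : x ∈ Ioi b
  · rw [indicator_of_mem h]
    exact le_max_of_le_left (sub_le_sub_right (exp_le_exp.2 (le_of_lt h)) _)
  · rw [indicator_of_notMem h]
    exact le_max_right _ _

/-- An exponential bound on the tail gives one on the call price, by the layer cake formula. -/
theorem exists_setIntegral_payoff_le (hE : Integrable (fun x => exp x) μ) {θ : ℝ} (hθ : 0 < θ) :
    ∃ D : ℝ, ∀ k B : ℝ, 0 ≤ k → (∀ x, k ≤ x → μ.real (Ioi x) ≤ B * exp (-((1 + θ) * x))) →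
      ∫ x in Ioi k, (exp x - exp k) ∂μ ≤ B * D := by
  -- The payoff exceeds `t > 0` only beyond `log (exp k + t)`, where the tail is at most `B (exp k +
  -- t) ^ (-(1 + θ))`; `k ≥ 0` makes the constant free of `k`.
  refine ⟨∫ t in Ioi (0 : ℝ), (t + 1) ^ (-(1 + θ)), fun k B hk hB => ?_⟩
  have hB0 : 0 ≤ B := nonneg_of_mul_nonneg_left (measureReal_nonneg.trans (hB k le_rfl)) (exp_pos _)
  rw [setIntegral_payoff_eq, (integrable_payoff hE k).integral_eq_integral_meas_lt
    (ae_of_all _ fun x => le_max_right _ _), ← integral_const_mul]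
  refine integral_mono_of_nonneg (ae_of_all _ fun t => measureReal_nonneg)
    ((integrableOn_add_rpow_Ioi_of_lt (by linarith) (by norm_num)).const_mul B) ?_
  filter_upwards [self_mem_ae_restrict measurableSet_Ioi] with t ht
  rw [mem_Ioi] at ht
  have hs : 0 < exp k + t := add_pos (exp_pos _) ht
  have hsub : {x | t < max (exp x - exp k) 0} ⊆ Ioi (log (exp k + t)) := by
    intro x hx
    rw [mem_ofPred_eq] at hx
    rcases lt_max_iff.1 hx with h | h
    · exact (log_lt_iff_lt_exp hs).2 (by linarith)
    · exact absurd h ht.not_gt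
  have hk' : k ≤ log (exp k + t) := by
    rw [le_log_iff_exp_le hs]
    linarith
  refine ((measureReal_mono hsub).trans (hB _ hk')).trans (mul_le_mul_of_nonneg_left ?_ hB0)
  have h1 : 1 ≤ exp k := one_le_exp hk
  rw [show -((1 + θ) * log (exp k + t)) = log (exp k + t) * -(1 + θ) by ring,
    ← rpow_def_of_pos hs]
  exact rpow_le_rpow_of_nonpos (by linarith) (by linarith) (by linarith)

/-! ### From the tail to the call price. -/

/-- Regular variation of the log-tail determines the logarithmic asymptotics of the call price. -/
theorem call_pos_and_equiv_of_regVar_tail {α : ℝ} (hα : 0 < α) (hε : 0 < ε)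
    (hI : Integrable (fun x => exp ((1 + ε) * x)) μ)
    (hg : RegVar α fun k => -log (μ.real (Ioi k))) :
    (∀ᶠ k in atTop, 0 < ∫ x in Ioi k, (exp x - exp k) ∂μ) ∧
    RegVar α (fun k => -log (μ.real (Ioi k)) - k) ∧
    Equiv (fun k => -log (∫ x in Ioi k, (exp x - exp k) ∂μ))
      (fun k => -log (μ.real (Ioi k)) - k) := by
  have hE := integrable_exp_of_exp_mul hε hI
  -- Since `log 0 = 0`, eventual positivity of the log-tail excludes a vanishing tail.
  have hF : ∀ᶠ k in atTop, 0 < μ.real (Ioi k) := by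
    filter_upwards [hg.eventually_pos] with k hk
    refine measureReal_nonneg.lt_of_ne fun h => ?_
    simp [← h] at hk
  have hlow : ∀ᶠ k in atTop, (1 + ε / 2) * k ≤ -log (μ.real (Ioi k)) := by
    filter_upwards [hF, eventually_mul_le_neg_log tendsto_id
      (show 1 + ε / 2 < 1 + ε by linarith) (∫ x, exp ((1 + ε) * x) ∂μ)] with k hk h
    exact h _ hk (measureReal_Ioi_le hε hI k)
  have hG := hg.sub_id (half_pos hε) hlow
  set G := fun k => -log (μ.real (Ioi k)) - k with hGdef
  have hFG : ∀ᶠ k in atTop, μ.real (Ioi k) = exp (-k - G k) := by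
    filter_upwards [hF] with k hk
    rw [hGdef, show -k - (-log (μ.real (Ioi k)) - k) = log (μ.real (Ioi k)) by ring, exp_log hk]
  have hGlow : ∀ᶠ k in atTop, ε / 2 * k ≤ G k := by
    filter_upwards [hlow] with k hk
    rw [hGdef]
    linarith
  have hGtop : Tendsto G atTop atTop :=
    tendsto_atTop_mono' _ hGlow (tendsto_id.const_mul_atTop (half_pos hε))
  -- Beyond `a * k` the payoff is at least `exp (a * k) / 2`, which cancels the factor `exp (-(a *
  -- k))` of the tail.
  have hlb : ∀ a : ℝ, 1 < a → ∀ᶠ k in atTop,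
      exp (-(G (a * k))) * (1 / 2) ≤ ∫ x in Ioi k, (exp x - exp k) ∂μ := by
    intro a ha
    have hT := tendsto_const_mul_atTop_self (zero_lt_one.trans ha)
    have hT' := tendsto_const_mul_atTop_self (sub_pos.2 ha)
    filter_upwards [hT.eventually hFG, hT'.eventually_ge_atTop (log 2)] with k h1 h2
    refine le_trans ?_ (le_setIntegral_payoff hE k (a * k))
    have h3 : exp k ≤ exp (a * k) / 2 := by
      rw [le_div_iff₀ two_pos, ← exp_log two_pos, ← exp_add]
      exact exp_le_exp.2 (by linarith)
    have h4 : exp (-(G (a * k))) = exp (a * k) * exp (-(a * k) - G (a * k)) := by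
      rw [← exp_add]
      ring_nf
    rw [h1, h4]
    have := exp_pos (-(a * k) - G (a * k))
    nlinarith
  have hcpos : ∀ᶠ k in atTop, 0 < ∫ x in Ioi k, (exp x - exp k) ∂μ := by
    filter_upwards [hlb 2 one_lt_two] with k hk
    exact lt_of_lt_of_le (by positivity) hk
  refine ⟨hcpos, hG, equiv_of_forall_bounds hG.eventually_pos (fun r hr => ?_)
    fun r hr hr1 => ?_⟩
  · obtain ⟨q, hq1, hqr⟩ := exists_between hr
    obtain ⟨p, hp1, hpq⟩ := exists_between hq1
    have hp0 : 0 < p := zero_lt_one.trans hp1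
    -- Chosen so that `G (a * k) / G k → p < q`.
    set a := p ^ (1 / α) with ha
    have ha1 : 1 < a := one_lt_rpow hp1 (by positivity)
    have hap : a ^ α = p := by
      rw [ha, ← rpow_mul hp0.le, one_div_mul_cancel hα.ne', rpow_one]
    have hlim := hG.tendsto a (zero_lt_one.trans ha1)
    rw [hap] at hlim
    filter_upwards [hlb a ha1, hlim.eventually_lt_const hpq, hG.eventually_pos,
      eventually_neg_log_le_mul hGtop hqr (show (0 : ℝ) < 1 / 2 by norm_num)] with k h1 h2 h3 h4
    refine h4 _ (le_trans ?_ h1)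
    rw [div_lt_iff₀ h3] at h2
    exact mul_le_mul_of_nonneg_right (exp_le_exp.2 (by linarith)) (by norm_num)
  · have hrs := lt_sq_half_one_add hr1
    set s := (1 + r) / 2 with hs
    have hs0 : 0 < s := by rw [hs]; linarith
    have hs1 : s < 1 := by rw [hs]; linarith
    -- Split `G x = s G x + (1 - s) G x`: the first share is at least `s² G k`, the second at least
    -- `(1 - s) (ε / 2) x`, which gives this `θ`.
    obtain ⟨D, hD⟩ := exists_setIntegral_payoff_le hE
      (mul_pos (sub_pos.2 hs1) (half_pos hε))
    obtain ⟨K, hK⟩ := eventually_atTop.1 (hFG.and hGlow)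
    filter_upwards [hcpos, hG.eventually_forall_ge hα hs0 hs1, eventually_ge_atTop K,
      eventually_ge_atTop 0, eventually_mul_le_neg_log hGtop hrs D] with k h1 h2 h3 h4 h5
    refine h5 _ h1 (hD k _ h4 fun x hx => ?_)
    have h6 := h2 x hx
    obtain ⟨h7, h8⟩ := hK x (h3.trans hx)
    rw [h7, ← exp_add]
    refine exp_le_exp.2 ?_
    have h9 := mul_le_mul_of_nonneg_left h6 hs0.le
    have h10 := mul_le_mul_of_nonneg_left h8 (sub_pos.2 hs1).le
    linarith

/-! ### From the density to the tail. -/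

theorem integrable_density {f : ℝ → ℝ} (hf : Measurable f) (hf0 : ∀ x, 0 ≤ f x)
    (hμ : μ = volume.withDensity fun x => ENNReal.ofReal (f x)) : Integrable f := by
  refine ⟨hf.aestronglyMeasurable, ?_⟩
  rw [hasFiniteIntegral_iff_ofReal (ae_of_all _ hf0)]
  have h : μ univ = ∫⁻ x, ENNReal.ofReal (f x) := by
    rw [hμ, withDensity_apply _ MeasurableSet.univ, Measure.restrict_univ]
  rw [← h]
  exact measure_lt_top _ _

/-- Regular variation of the log-density determines the logarithmic asymptotics of the tail. -/
theorem tail_equiv_of_regVar_density {α : ℝ} (hα : 0 < α) (hε : 0 < ε)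
    (hI : Integrable (fun x => exp ((1 + ε) * x)) μ) {f : ℝ → ℝ} (hf : Measurable f)
    (hf0 : ∀ x, 0 ≤ f x) (hμ : μ = volume.withDensity fun x => ENNReal.ofReal (f x))
    (hl : RegVar α fun k => -log (f k)) :
    (∀ᶠ k in atTop, (1 + ε / 4) * k ≤ -log (f k)) ∧
    Equiv (fun k => -log (μ.real (Ioi k))) (fun k => -log (f k)) := by
  have hfi := integrable_density hf hf0 hμ
  have hF := measureReal_Ioi_eq_integral_density hf hf0 hμ
  set l := fun k => -log (f k) with hldef
  have hfl : ∀ᶠ k in atTop, f k = exp (-l k) := by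
    filter_upwards [hl.eventually_pos] with k hk
    have : f k ≠ 0 := by
      intro h
      simp [hldef, h] at hk
    rw [hldef, neg_neg, exp_log ((hf0 k).lt_of_ne' this)]
  have hlb : ∀ q : ℝ, 1 < q → ∃ C : ℝ, 0 < C ∧ ∀ᶠ k in atTop,
      exp (-(q * l k)) * C ≤ μ.real (Ioi k) := by
    intro q hq
    -- One factor `exp δ = √q` pays for the uniform convergence error, the other for `(x / k) ^ α ≤
    -- a ^ α`; the `min 1` below keeps `a ≤ e`.
    set δ := log q / 2 with hδ
    have hδ0 : 0 < δ := half_pos (log_pos hq)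
    set a := exp (min 1 (δ / α)) with ha
    have ha1 : 1 < a := one_lt_exp_iff.2 (lt_min one_pos (by positivity))
    refine ⟨a - 1, sub_pos.2 ha1, ?_⟩
    obtain ⟨K, hK⟩ := eventually_atTop.1 hfl
    filter_upwards [hl.eventually_forall_Icc hδ0, hl.eventually_pos, eventually_ge_atTop K,
      eventually_ge_atTop 1] with k h1 h2 h3 h4
    have h0 : 0 < k := by linarith
    have hka : k ≤ a * k := le_mul_of_one_le_left h0.le ha1.le
    have h5 : ∀ x ∈ Ioc k (a * k), exp (-(q * l k)) ≤ f x := by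
      intro x hx
      rw [hK x (h3.trans hx.1.le)]
      have ht1 : 1 ≤ x / k := (one_le_div h0).2 hx.1.le
      have hta : x / k ≤ a := (div_le_iff₀ h0).2 hx.2
      have h6 := (h1 (x / k) ⟨ht1, hta.trans (exp_le_exp.2 (min_le_left _ _))⟩).2
      rw [div_mul_cancel₀ _ h0.ne'] at h6
      have h7 : (x / k) ^ α ≤ exp δ := by
        refine (rpow_le_rpow (by linarith) hta hα.le).trans ?_
        rw [ha, ← exp_mul]
        refine exp_le_exp.2 ?_
        calc min 1 (δ / α) * α ≤ δ / α * α :=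
              mul_le_mul_of_nonneg_right (min_le_right _ _) hα.le
          _ = δ := div_mul_cancel₀ _ hα.ne'
      have h8 : exp δ * exp δ = q := by
        rw [← exp_add, hδ, add_halves, exp_log (zero_lt_one.trans hq)]
      refine exp_le_exp.2 (neg_le_neg (h6.trans ?_))
      rw [← h8]
      gcongr
    rw [hF]
    calc exp (-(q * l k)) * (a - 1) ≤ exp (-(q * l k)) * (a * k - k) := by
          refine mul_le_mul_of_nonneg_left ?_ (exp_pos _).le
          nlinarith
      _ = ∫ _ in Ioc k (a * k), exp (-(q * l k)) := by
          rw [setIntegral_const, Real.volume_real_Ioc_of_le hka, smul_eq_mul, mul_comm]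
      _ ≤ ∫ x in Ioc k (a * k), f x :=
          setIntegral_mono_on (integrableOn_const (by simp)) hfi.integrableOn measurableSet_Ioc h5
      _ ≤ ∫ x in Ioi k, f x :=
          setIntegral_mono_set hfi.integrableOn (ae_of_all _ hf0)
            (Ioc_subset_Ioi_self.eventuallyLE)
  have hFpos : ∀ᶠ k in atTop, 0 < μ.real (Ioi k) := by
    obtain ⟨C, hC, h⟩ := hlb 2 one_lt_two
    filter_upwards [h] with k hk
    exact lt_of_lt_of_le (by positivity) hk
  have hFlow : ∀ᶠ k in atTop, (1 + ε / 2) * k ≤ -log (μ.real (Ioi k)) := by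
    filter_upwards [hFpos, eventually_mul_le_neg_log tendsto_id
      (show 1 + ε / 2 < 1 + ε by linarith) (∫ x, exp ((1 + ε) * x) ∂μ)] with k hk h
    exact h _ hk (measureReal_Ioi_le hε hI k)
  -- Divergence is inherited from the tail: `2 l k` dominates the log-tail up to a constant, and the
  -- moment makes that grow linearly.
  have hltop : Tendsto l atTop atTop := by
    obtain ⟨C, hC, h⟩ := hlb 2 one_lt_two
    have h1 : Tendsto (fun k : ℝ => ((1 + ε / 2) * k + log C) / 2) atTop atTop :=
      (tendsto_atTop_add_const_right _ _
        (tendsto_id.const_mul_atTop (by positivity))).atTop_div_const two_pos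
    refine tendsto_atTop_mono' _ ?_ h1
    filter_upwards [h, hFlow] with k hk hk'
    have h2 := log_le_log (mul_pos (exp_pos _) hC) hk
    rw [log_mul (exp_pos _).ne' hC.ne', log_exp] at h2
    linarith
  have hup : ∀ r : ℝ, 1 < r → ∀ᶠ k in atTop, -log (μ.real (Ioi k)) ≤ r * l k := by
    intro r hr
    obtain ⟨q, hq1, hqr⟩ := exists_between hr
    obtain ⟨C, hC, h⟩ := hlb q hq1
    filter_upwards [h, eventually_neg_log_le_mul hltop hqr hC] with k hk hk'
    exact hk' _ hk
  -- Passing from `ε / 2` to `ε / 4` absorbs the factor `r > 1` of `hup`.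
  have hllow : ∀ᶠ k in atTop, (1 + ε / 4) * k ≤ l k := by
    have hr : 1 < (1 + ε / 2) / (1 + ε / 4) := by
      rw [one_lt_div (by positivity)]
      linarith
    filter_upwards [hup _ hr, hFlow] with k hk hk'
    have h1 := hk'.trans hk
    rw [div_mul_eq_mul_div, le_div_iff₀ (by positivity), mul_assoc] at h1
    rw [mul_comm]
    exact le_of_mul_le_mul_left h1 (by positivity)
  refine ⟨hllow, equiv_of_forall_bounds hl.eventually_pos hup fun r hr hr1 => ?_⟩
  have hrs := lt_sq_half_one_add hr1
  set s := (1 + r) / 2 with hs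
  have hs0 : 0 < s := by rw [hs]; linarith
  have hs1 : s < 1 := by rw [hs]; linarith
  have hsn : -(1 - s) < 0 := by linarith
  obtain ⟨K, hK⟩ := eventually_atTop.1 (hfl.and hllow)
  filter_upwards [hFpos, hl.eventually_forall_ge hα hs0 hs1, eventually_ge_atTop K,
    eventually_ge_atTop 0, eventually_mul_le_neg_log hltop hrs
      (∫ x in Ioi (0 : ℝ), exp (-(1 - s) * x))] with k h1 h2 h3 h4 h5
  refine h5 _ h1 ?_
  have hint := (integrableOn_exp_mul_Ioi hsn 0)
  rw [hF]
  calc ∫ x in Ioi k, f x ≤ ∫ x in Ioi k, exp (-(s ^ 2 * l k)) * exp (-(1 - s) * x) := by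
        refine setIntegral_mono_on hfi.integrableOn
          ((hint.mono_set (Ioi_subset_Ioi h4)).const_mul _) measurableSet_Ioi fun x hx => ?_
        have hx' : k ≤ x := le_of_lt hx
        have h6 := h2 x hx'
        obtain ⟨h7, h8⟩ := hK x (h3.trans hx')
        rw [h7, ← exp_add]
        refine exp_le_exp.2 ?_
        have h9 := mul_le_mul_of_nonneg_left h6 hs0.le
        have h11 : x ≤ l x := by
          have : 0 ≤ ε / 4 * x := mul_nonneg (by positivity) (h4.trans hx')
          linarith
        have h10 := mul_le_mul_of_nonneg_left h11 (sub_pos.2 hs1).le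
        linarith
    _ = exp (-(s ^ 2 * l k)) * ∫ x in Ioi k, exp (-(1 - s) * x) := integral_const_mul _ _
    _ ≤ _ := by
        refine mul_le_mul_of_nonneg_left ?_ (exp_pos _).le
        exact setIntegral_mono_set hint (ae_of_all _ fun x => (exp_pos _).le)
          (Ioi_subset_Ioi h4).eventuallyLE

end

/-! ### Implied volatility asymptotics. -/

section

variable {Ω : Type*} [MeasurableSpace Ω] {P : Measure Ω} [IsProbabilityMeasure P] {X : Ω → ℝ}
  {ε α : ℝ}

theorem tail_eq (hX : AEMeasurable X P) : tail P X = fun k => (P.map X).real (Ioi k) := by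
  have := Measure.isProbabilityMeasure_map (μ := P) hX
  funext k
  rw [tail, cdf_eq_real, ← compl_Iic, probReal_compl_eq_one_sub measurableSet_Iic]

theorem call_nonneg (P : Measure Ω) (X : Ω → ℝ) (k : ℝ) : 0 ≤ call P X k :=
  setIntegral_nonneg measurableSet_Ioi fun _ hx => sub_nonneg.2 (exp_le_exp.2 (le_of_lt hx))

theorem eventually_mul_le_neg_log_call (hX : AEMeasurable X P) (hε : 0 < ε)
    (hI : Integrable (fun x => exp ((1 + ε) * x)) (P.map X)) :
    ∀ᶠ k in atTop, 0 < call P X k → ε / 2 * k ≤ -log (call P X k) := by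
  have := Measure.isProbabilityMeasure_map (μ := P) hX
  filter_upwards [eventually_mul_le_neg_log tendsto_id (half_lt_self hε)
    (∫ x, exp ((1 + ε) * x) ∂(P.map X))] with k hk h0
  exact hk _ h0 (setIntegral_payoff_le hε hI k)

theorem eventually_impliedVol (hX : AEMeasurable X P) (hε : 0 < ε)
    (hI : Integrable (fun x => exp ((1 + ε) * x)) (P.map X)) :
    ∀ᶠ k in atTop, 0 < call P X k →
      0 < impliedVol P X k ∧ cBS k (impliedVol P X k) = call P X k ∧
      ∀ σ : ℝ, 0 < σ → cBS k σ = call P X k → σ = impliedVol P X k := by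
  filter_upwards [eventually_mul_le_neg_log_call hX hε hI, eventually_gt_atTop 0] with k hk hk0 hc
  have h1 : log (call P X k) < 0 := by
    have : 0 < ε / 2 * k := by positivity
    linarith [hk hc]
  obtain ⟨σ, hσ, hσc⟩ := exists_cBS_eq hk0 hc (not_le.1 fun h => h1.not_ge (log_nonneg h))
  have hset : {τ : ℝ | 0 < τ ∧ cBS k τ = call P X k} = {σ} :=
    eq_singleton_iff_unique_mem.2 ⟨⟨hσ, hσc⟩, fun τ hτ => cBS_inj hτ.1 hσ (hτ.2.trans hσc.symm)⟩
  have hV : impliedVol P X k = σ := by rw [impliedVol, hset, csInf_singleton]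
  rw [hV]
  exact ⟨hσ, hσc, fun τ hτ h => cBS_inj hτ hσ (h.trans hσc.symm)⟩

theorem impliedVol_equiv_psi (hX : AEMeasurable X P) (hε : 0 < ε)
    (hI : Integrable (fun x => exp ((1 + ε) * x)) (P.map X))
    (hc : ∀ᶠ k in atTop, 0 < call P X k) :
    Equiv (fun k => impliedVol P X k ^ 2 / k) (fun k => psi (-log (call P X k) / k)) := by
  refine equiv_psi_of_cBS_eq (half_pos hε) ?_ hc ?_
  · filter_upwards [eventually_impliedVol hX hε hI, hc] with k hk hk'
    exact ⟨(hk hk').1, (hk hk').2.1⟩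
  · filter_upwards [eventually_mul_le_neg_log_call hX hε hI, hc, eventually_gt_atTop 0]
      with k hk hk' hk0
    exact (le_div_iff₀ hk0).2 (hk hk')

/-- The implied volatility asymptotics in terms of any `a ∼ -log c(k) / k`. -/
theorem impliedVol_equiv_psi_of_equiv (hX : AEMeasurable X P) (hε : 0 < ε)
    (hI : Integrable (fun x => exp ((1 + ε) * x)) (P.map X))
    (hc : ∀ᶠ k in atTop, 0 < call P X k) {a : ℝ → ℝ} (ha : ∀ᶠ k in atTop, 0 < a k)
    (h : Equiv (fun k => -log (call P X k) / k) a) :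
    Equiv (fun k => impliedVol P X k ^ 2 / k) (fun k => psi (a k)) :=
  (impliedVol_equiv_psi hX hε hI hc).trans (equiv_psi_of_equiv ha h)

theorem tendsto_zero_and_equiv_of_equiv_psi {v a b : ℝ → ℝ} (hv : Equiv v fun k => psi (a k))
    (ha : Tendsto a atTop atTop) (hab : Equiv (fun k => 1 / (2 * a k)) b) :
    Tendsto v atTop (𝓝 0) ∧ Equiv v b := by
  refine ⟨?_, hv.trans ((psi_equiv_of_atTop ha).trans hab)⟩
  have h := Tendsto.mul hv (psi_tendsto_zero ha)
  rw [mul_zero] at h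
  refine h.congr' ?_
  filter_upwards [ha.eventually_ge_atTop 0] with k hk
  exact div_mul_cancel₀ _ (psi_pos hk).ne'

theorem regVar_neg_log_call (hX : AEMeasurable X P) (hα : 0 < α) (hε : 0 < ε)
    (hI : Integrable (fun x => exp ((1 + ε) * x)) (P.map X))
    (hg : RegVar α fun k => -log (tail P X k)) : RegVar α fun k => -log (call P X k) := by
  have := Measure.isProbabilityMeasure_map (μ := P) hX
  rw [tail_eq hX] at hg
  obtain ⟨-, hG, hE⟩ := call_pos_and_equiv_of_regVar_tail hα hε hI hg
  refine hG.of_equiv ?_ hE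
  exact (measurable_log.comp
    (antitone_setIntegral_payoff (integrable_exp_of_exp_mul hε hI)).measurable).neg

theorem neg_one_sub_log_div_eq (y : ℝ → ℝ) :
    (fun k => (-log (y k) - k) / k) =ᶠ[atTop] fun k => -1 - log (y k) / k := by
  filter_upwards [eventually_ne_atTop 0] with k hk
  field_simp
  ring

theorem Equiv.congr {g h g' h' : ℝ → ℝ} (H : Equiv g h) (hg : g =ᶠ[atTop] g')
    (hh : h =ᶠ[atTop] h') : Equiv g' h' :=
  Tendsto.congr' (hg.div hh) H

theorem Equiv.div_id {g h : ℝ → ℝ} (H : Equiv g h) : Equiv (fun k => g k / k) fun k => h k / k := by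
  refine Tendsto.congr' ?_ H
  filter_upwards [eventually_ne_atTop 0] with k hk
  rw [div_div_div_cancel_right₀ hk]

/-- The relative error grows by the factor `h / (h - k)`, at most `(1 + δ) / δ`. -/
theorem Equiv.sub_id {g h : ℝ → ℝ} (H : Equiv g h) {δ : ℝ} (hδ : 0 < δ)
    (hl : ∀ᶠ k in atTop, (1 + δ) * k ≤ h k) :
    Equiv (fun k => g k - k) fun k => h k - k := by
  have h1 : Tendsto (fun k => g k / h k - 1) atTop (𝓝 0) := by
    simpa using Tendsto.sub_const H 1
  have h2 : Tendsto (fun k => (g k / h k - 1) * (h k / (h k - k))) atTop (𝓝 0) := by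
    refine h1.zero_mul_isBoundedUnder_le ⟨(1 + δ) / δ, eventually_map.2 ?_⟩
    filter_upwards [hl, eventually_gt_atTop 0] with k hk hk0
    have h3 : 0 < h k - k := by nlinarith
    have h4 : 0 < h k := by linarith
    simp only [Function.comp, norm_eq_abs]
    rw [abs_of_pos (div_pos h4 h3), div_le_div_iff₀ h3 hδ]
    linarith
  have h3 := h2.add_const 1
  rw [zero_add] at h3
  refine h3.congr' ?_
  filter_upwards [hl, eventually_gt_atTop 0] with k hk hk0
  have h3 : 0 < h k - k := by nlinarith
  have h4 : 0 < h k := by linarith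
  field_simp
  ring

theorem tail_consequences (hX : AEMeasurable X P) (hα : 0 < α) (hε : 0 < ε)
    (hI : Integrable (fun x => exp ((1 + ε) * x)) (P.map X))
    (hg : RegVar α fun k => -log (tail P X k)) :
    (∀ᶠ k in atTop, 0 < -1 - log (tail P X k) / k) ∧
    Equiv (fun k => -log (call P X k)) (fun k => -k - log (tail P X k)) ∧
    Equiv (fun k => impliedVol P X k ^ 2 / k) (fun k => psi (-1 - log (tail P X k) / k)) := by
  have := Measure.isProbabilityMeasure_map (μ := P) hX
  rw [tail_eq hX] at hg ⊢
  obtain ⟨hc, hG, hE⟩ := call_pos_and_equiv_of_regVar_tail hα hε hI hg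
  have hpos : ∀ᶠ k in atTop, 0 < -1 - log ((P.map X).real (Ioi k)) / k := by
    filter_upwards [hG.eventually_pos, eventually_gt_atTop 0,
      neg_one_sub_log_div_eq fun k => (P.map X).real (Ioi k)] with k h1 h2 h3
    rw [← h3]
    exact div_pos h1 h2
  refine ⟨hpos, hE.congr EventuallyEq.rfl (.of_forall fun k => by ring), ?_⟩
  exact impliedVol_equiv_psi_of_equiv hX hε hI hc hpos
    (hE.div_id.congr EventuallyEq.rfl (neg_one_sub_log_div_eq _))

theorem density_consequences (hX : AEMeasurable X P) (hα : 0 < α) (hε : 0 < ε)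
    (hI : Integrable (fun x => exp ((1 + ε) * x)) (P.map X)) {f : ℝ → ℝ}
    (hf : IsDensity P X f) (hl : RegVar α fun k => -log (f k)) :
    RegVar α (fun k => -log (tail P X k)) ∧
    Equiv (fun k => -log (f k)) (fun k => -log (tail P X k)) ∧
    Equiv (fun k => impliedVol P X k ^ 2 / k) (fun k => psi (-1 - log (f k) / k)) := by
  have := Measure.isProbabilityMeasure_map (μ := P) hX
  obtain ⟨hlow, hE⟩ := tail_equiv_of_regVar_density hα hε hI hf.measurable hf.nonneg hf.map_eq hl
  have hm : Measurable fun k => -log ((P.map X).real (Ioi k)) := by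
    have : Antitone fun k => (P.map X).real (Ioi k) := fun _ _ h =>
      measureReal_mono (Ioi_subset_Ioi h)
    exact (measurable_log.comp this.measurable).neg
  have hg : RegVar α (fun k => -log (tail P X k)) := by
    rw [tail_eq hX]
    exact hl.of_equiv hm hE
  obtain ⟨hpos, -, hV⟩ := tail_consequences hX hα hε hI hg
  rw [tail_eq hX] at hpos hV
  have hE' := ((hE.sub_id (by positivity) hlow).div_id.congr
    (neg_one_sub_log_div_eq _) (neg_one_sub_log_div_eq _))
  refine ⟨hg, ?_, hV.trans (equiv_psi_of_equiv (hE'.symm.eventually_pos hpos) hE')⟩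
  rw [tail_eq hX]
  exact hE.symm

/-- The shift by `-1` is negligible against a divergent quotient. -/
theorem equiv_one_div_of_tendsto {y : ℝ → ℝ}
    (hy : Tendsto (fun k => -log (y k) / k) atTop atTop) :
    Tendsto (fun k => -1 - log (y k) / k) atTop atTop ∧
    Equiv (fun k => 1 / (2 * (-1 - log (y k) / k))) fun k => 1 / (-2 * log (y k) / k) := by
  have h1 : Tendsto (fun k => -1 - log (y k) / k) atTop atTop :=
    (tendsto_atTop_add_const_left _ (-1) hy).congr fun k => by ring
  refine ⟨h1, ?_⟩
  have h2 := (h1.inv_tendsto_atTop).const_add 1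
  rw [add_zero] at h2
  refine h2.congr' ?_
  filter_upwards [h1.eventually_gt_atTop 0] with k hk
  simp only [Pi.inv_apply]
  rw [show -2 * log (y k) / k = 2 * ((-1 - log (y k) / k) + 1) by ring]
  field_simp

end

end TailWing

theorem theorem1 {Ω : Type*} [MeasurableSpace Ω] (P : Measure Ω) [IsProbabilityMeasure P]
    (X : Ω → ℝ) (hX : AEMeasurable X P)
    (hIR : ∃ ε : ℝ, 0 < ε ∧ Integrable (fun ω => Real.exp ((1 + ε) * X ω)) P)
    (α : ℝ) (hα : 0 < α) :
    -- the implied volatility is well defined: the unique solution of the pricing equation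
    (∀ᶠ k in atTop, 0 < TailWing.call P X k →
      0 < TailWing.impliedVol P X k ∧
      TailWing.cBS k (TailWing.impliedVol P X k) = TailWing.call P X k ∧
      ∀ σ : ℝ, 0 < σ → TailWing.cBS k σ = TailWing.call P X k →
        σ = TailWing.impliedVol P X k) ∧
    -- (i) implies (ii)
    (∀ f : ℝ → ℝ, TailWing.IsDensity P X f →
      TailWing.RegVar α (fun k => -Real.log (f k)) →
      TailWing.RegVar α (fun k => -Real.log (TailWing.tail P X k))) ∧
    -- (ii) implies (iii)
    (TailWing.RegVar α (fun k => -Real.log (TailWing.tail P X k)) →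
      TailWing.RegVar α (fun k => -Real.log (TailWing.call P X k))) ∧
    -- (iii) implies (iv)
    (TailWing.RegVar α (fun k => -Real.log (TailWing.call P X k)) →
      TailWing.Equiv (fun k => TailWing.impliedVol P X k ^ 2 / k)
        (fun k => TailWing.psi (-Real.log (TailWing.call P X k) / k))) ∧
    -- consequences of (ii)
    (TailWing.RegVar α (fun k => -Real.log (TailWing.tail P X k)) →
      TailWing.Equiv (fun k => -Real.log (TailWing.call P X k))
        (fun k => -k - Real.log (TailWing.tail P X k)) ∧
      TailWing.Equiv (fun k => TailWing.impliedVol P X k ^ 2 / k)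
        (fun k => TailWing.psi (-1 - Real.log (TailWing.tail P X k) / k))) ∧
    -- consequences of (i)
    (∀ f : ℝ → ℝ, TailWing.IsDensity P X f →
      TailWing.RegVar α (fun k => -Real.log (f k)) →
      TailWing.Equiv (fun k => -Real.log (f k))
        (fun k => -Real.log (TailWing.tail P X k)) ∧
      TailWing.Equiv (fun k => TailWing.impliedVol P X k ^ 2 / k)
        (fun k => TailWing.psi (-1 - Real.log (f k) / k))) ∧
    -- sublinear case, in terms of the density
    (∀ f : ℝ → ℝ, TailWing.IsDensity P X f →
      TailWing.RegVar α (fun k => -Real.log (f k)) →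
      Tendsto (fun k => -Real.log (f k) / k) atTop atTop →
      Tendsto (fun k => TailWing.impliedVol P X k ^ 2 / k) atTop (𝓝 0) ∧
      TailWing.Equiv (fun k => TailWing.impliedVol P X k ^ 2 / k)
        (fun k => 1 / (-2 * Real.log (f k) / k))) ∧
    -- sublinear case, in terms of the tail
    (TailWing.RegVar α (fun k => -Real.log (TailWing.tail P X k)) →
      Tendsto (fun k => -Real.log (TailWing.tail P X k) / k) atTop atTop →
      Tendsto (fun k => TailWing.impliedVol P X k ^ 2 / k) atTop (𝓝 0) ∧
      TailWing.Equiv (fun k => TailWing.impliedVol P X k ^ 2 / k)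
        (fun k => 1 / (-2 * Real.log (TailWing.tail P X k) / k))) ∧
    -- sublinear case, in terms of the call price (no regular variation needed)
    (Tendsto (fun k => -Real.log (TailWing.call P X k) / k) atTop atTop →
      Tendsto (fun k => TailWing.impliedVol P X k ^ 2 / k) atTop (𝓝 0) ∧
      TailWing.Equiv (fun k => TailWing.impliedVol P X k ^ 2 / k)
        (fun k => 1 / (-2 * Real.log (TailWing.call P X k) / k))) := by
  obtain ⟨ε, hε, hI⟩ := hIR
  have hI' : Integrable (fun x => Real.exp ((1 + ε) * x)) (P.map X) := by
    rw [integrable_map_measure (by fun_prop) hX]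
    exact hI
  refine ⟨TailWing.eventually_impliedVol hX hε hI',
    fun f hf hl => (TailWing.density_consequences hX hα hε hI' hf hl).1,
    TailWing.regVar_neg_log_call hX hα hε hI', fun hc => ?_,
    fun hg => (TailWing.tail_consequences hX hα hε hI' hg).2,
    fun f hf hl => (TailWing.density_consequences hX hα hε hI' hf hl).2,
    fun f hf hl hlim => ?_, fun hg hlim => ?_, fun hlim => ?_⟩
  -- From (iii) only eventual positivity of the call price is needed, and `log 0 = 0` yields it.
  · refine TailWing.impliedVol_equiv_psi hX hε hI' ?_
    filter_upwards [hc.eventually_pos] with k hk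
    exact (TailWing.call_nonneg P X k).lt_of_ne fun h => by simp [← h] at hk
  · obtain ⟨h1, h2⟩ := TailWing.equiv_one_div_of_tendsto hlim
    exact TailWing.tendsto_zero_and_equiv_of_equiv_psi
      (TailWing.density_consequences hX hα hε hI' hf hl).2.2 h1 h2
  · obtain ⟨h1, h2⟩ := TailWing.equiv_one_div_of_tendsto hlim
    exact TailWing.tendsto_zero_and_equiv_of_equiv_psi
      (TailWing.tail_consequences hX hα hε hI' hg).2.2 h1 h2
  · have hc : ∀ᶠ k in atTop, 0 < TailWing.call P X k := by
      filter_upwards [hlim.eventually_gt_atTop 0] with k hk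
      exact (TailWing.call_nonneg P X k).lt_of_ne fun h => by simp [← h] at hk
    refine TailWing.tendsto_zero_and_equiv_of_equiv_psi
      (TailWing.impliedVol_equiv_psi hX hε hI' hc) hlim ?_
    refine Tendsto.congr' ?_ tendsto_const_nhds
    filter_upwards [hlim.eventually_gt_atTop 0] with k hk
    rw [show -2 * Real.log (TailWing.call P X k) / k
      = 2 * (-Real.log (TailWing.call P X k) / k) by ring, div_self (by positivity)]
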